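/- Let $N$ be a finite directed graph with node set $V$ and arc set $A$ in which every arc $a=vw$ has a capacity $u_a\in\mathbb R_{>0}\cup\{\infty\}$ and a transit time $\tau_a\in\mathbb R_{\ge 0}$, together with a set of terminals $S\subseteq V$ partitioned into sources $S^+$ and sinks $S^-$, such that no arc enters a source and no arc leaves a sink. Let $\theta\in\mathbb R_{\ge 0}$ be a time horizon. Transit times and horizon are arbitrary nonnegative reals, not necessarily rational. For $X\subseteq S$, a feasible flow over time with time horizon $\theta$ from $S^+\cap X$ to $S^-\setminus X$ consists of a Lebesgue integrable function $f_a:\mathbb R\to\mathbb R$ for every arc $a$, where $f_a(t)$ is the rate at which flow enters $a$ at time $t$ (this flow leaves $a$ at time $t+\tau_a$), such that - $0\le f_a(t)\le u_a$ for all $a\in A$ and $t\in\mathbb R$; - for every $a\in A$ and every $t\notin[0,\theta)$, $f_a(t)=0$ and $f_a(t-\tau_a)=0$; - for every $t\in\mathbb R$ and every node $v\notin (S^+\cap X)\cup(S^-\setminus X)$, $\sum_{a\text{ leaving }v}f_a(t)=\sum_{a\text{ entering }v}f_a(t-\tau_a)$. The amount of flow sent by $f$ is $\sum_{s\in S^+\cap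 X}\int_{\mathbb R}\Bigl(\sum_{a\text{ leaving }s}f_a(t)-\sum_{a\text{ entering }s}f_a(t-\tau_a)\Bigr)\,dt$. Let $o(X)\in[0,\infty]$ be the supremum of the amounts sent by such flows. Then $o(X)$ is finite for all $X\subseteq S$ if all capacities are finite; whenever $o(X)$ is finite, it is a maximum, i.e. it is attained by a feasible flow over time; and the function $o:2^S\to[0,\infty]$ is submodular: $$o(X\cup Y)+o(X\cap Y)\le o(X)+o(Y)\qquad\text{for all }X,Y\subseteq S.$$ In particular, whenever $o$ takes only finite values, $o:2^S\to\mathbb R$ is a submodular real-valued function. -/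

import Mathlib

open scoped ENNReal

/-- A flow-over-time network on a directed graph with node type `V` and arc type `A` (both are
assumed finite where the notion is used; parallel arcs are allowed).  Every arc `a` leads from
`tail a` to `head a`, has a positive, possibly infinite capacity and a nonnegative real transit
time.  The terminals are partitioned into sources and sinks; sources have no incoming and sinks
have no outgoing arcs. -/
structure Network (V A : Type*) where
  tail : A → V
  head : A → V
  cap : A → ℝ≥0∞
  transit : A → ℝ
  sources : Finset V
  sinks : Finset V
  cap_pos : ∀ a, 0 < cap a
  transit_nonneg : ∀ a, 0 ≤ transit a
  disjoint_sources_sinks : Disjoint sources sinks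
  no_arc_into_source : ∀ a, head a ∉ sources
  no_arc_out_of_sink : ∀ a, tail a ∉ sinks

namespace Network

variable {V A : Type*} [Fintype A] [DecidableEq V]

/-- The set of terminals. -/
def terminals (N : Network V A) : Finset V := N.sources ∪ N.sinks

/-- The net rate of flow leaving node `v` at time `t`.  Here `f a t` is the rate at which flow
enters the arc `a` at its tail at time `t`; this flow arrives at the head of `a` at time
`t + transit a`, so that the outflow rate at the head of `a` at time `t` is
`f a (t - transit a)`. -/
noncomputable def netOut (N : Network V A) (f : A → ℝ → ℝ) (v : V) (t : ℝ) : ℝ :=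
  (∑ a with N.tail a = v, f a t) - ∑ a with N.head a = v, f a (t - N.transit a)

/-- `f` is a flow over time all of whose sources and sinks belong to `T`: the flow rates are
Lebesgue integrable, and flow is conserved at all times at every node outside `T`. -/
def IsFlowOverTime (N : Network V A) (T : Finset V) (f : A → ℝ → ℝ) : Prop :=
  (∀ a, MeasureTheory.Integrable (f a)) ∧ ∀ v, v ∉ T → ∀ t, N.netOut f v t = 0

/-- The capacity constraints: at all times the flow rate entering an arc is nonnegative and at
most the capacity of the arc.  (Nonnegativity is the capacity constraint of the reverse arc,
which has capacity zero.) -/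
def RespectsCapacities (N : Network V A) (f : A → ℝ → ℝ) : Prop :=
  ∀ a t, 0 ≤ f a t ∧ ENNReal.ofReal (f a t) ≤ N.cap a

/-- `f` has time horizon `θ`: outside `[0, θ)` no flow enters an arc at its tail and no flow
leaves an arc at its head.  (The latter is the condition for the reverse arc.) -/
def HasTimeHorizon (N : Network V A) (θ : ℝ) (f : A → ℝ → ℝ) : Prop :=
  ∀ a t, (t < 0 ∨ θ ≤ t) → f a t = 0 ∧ f a (t - N.transit a) = 0

/-- `f` is a feasible flow over time with time horizon `θ` which sends flow from the sources in
`X` to the sinks outside `X`: flow is conserved at every other node. -/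
def IsFeasible (N : Network V A) (θ : ℝ) (X : Finset V) (f : A → ℝ → ℝ) : Prop :=
  N.IsFlowOverTime (N.sources ∩ X ∪ N.sinks \ X) f ∧ N.RespectsCapacities f ∧
    N.HasTimeHorizon θ f

/-- The amount of flow which `f` sends out of the sources in `X`. -/
noncomputable def amount (N : Network V A) (X : Finset V) (f : A → ℝ → ℝ) : ℝ :=
  ∑ s ∈ N.sources ∩ X, ∫ t, N.netOut f s t

/-- The set of all amounts of flow that feasible flows over time with time horizon `θ` send from
the sources in `X` to the sinks outside `X`. -/
def amounts (N : Network V A) (θ : ℝ) (X : Finset V) : Set ℝ :=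
  {r | ∃ f, N.IsFeasible θ X f ∧ N.amount X f = r}

/-- The maximum flow over time function: the maximum (a priori the supremum, infinite if the
amounts are unbounded) amount of flow that a feasible flow over time with time horizon `θ` can
send from the sources in `X` to the sinks outside `X`. -/
noncomputable def maxFlow (N : Network V A) (θ : ℝ) (X : Finset V) : ℝ≥0∞ :=
  ⨆ r ∈ N.amounts θ X, ENNReal.ofReal r

end Network

/-- Submodularity of a set function `g` on the subsets of a finite set `S`. -/
def IsSubmodularOn {V : Type*} [DecidableEq V] (S : Finset V) (g : Finset V → ℝ≥0∞) : Prop :=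
  ∀ X ⊆ S, ∀ Y ⊆ S, g (X ∪ Y) + g (X ∩ Y) ≤ g X + g Y

/-!
The theorem follows from a max-flow min-cut theorem for flows over time.  A cut over time is given
by switching times `p v ∈ [0, θ]`, node `v` being on the source side from time `p v` on, with
`p = 0` on the sources in `X` and `p = θ` on the sinks outside `X`.  Its capacity is
`∑ a, cap a * (p (head a) - p (tail a) - transit a)⁺`.  This is submodular in `p`, because each
summand is a convex function of a difference; and the minimum and the maximum of cuts for `X` and
`Y` are cuts for `X ∪ Y` and `X ∩ Y`.  Submodularity of the maximum flow is therefore inherited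
from that of the cut capacity.

Weak duality (`amount_le_cutCapacity`) is obtained by integrating the net outflow of every node `v`
over `[p v, ∞)`.  For strong duality (`exists_cutCapacity_le_amount`), consider the finitely many
walks `l` without repeated arcs that lead from a source in `X` to a sink outside `X` and have
transit time `τ l < θ`, and the linear program of maximizing `∑ l, (θ - τ l) * x l` over the rates
`x ≥ 0` that respect the finite capacities.  A solution `x` gives a flow over time by sending flow
at rate `x l` along each `l` during `[0, θ - τ l)` (`isFeasible_repeatedFlow`,
`amount_repeatedFlow`).  A dual solution `y` gives a cut over time: the earliest arrival times with
respect to the transit times `transit + y`, cut off at `θ` (`isSeparating_arrivalTime`,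
`arrivalTime_head_le`).  Linear programming duality (`exists_packing_multipliers`) makes the two
values agree.  The program attains its maximum unless some walk has no finite capacity at all, in
which case the maximum flow is infinite.
-/

open scoped ENNReal

/-! ### Duality for packing linear programs -/

theorem convex_combination_lt {a b p q r s : ℝ} (ha : 0 ≤ a) (hb : 0 ≤ b) (hab : a + b = 1)
    (hpr : p < r) (hqs : q < s) : a * p + b * q < a * r + b * s := by
  rcases ha.eq_or_lt with rfl | ha
  · simpa [(zero_add b).symm.trans hab] using hqs
  · exact add_lt_add_of_lt_of_le (by gcongr) (by gcongr)

theorem nonpos_of_forall_add_mul_nonpos {a b : ℝ} (h : ∀ t : ℝ, 0 ≤ t → a + t * b ≤ 0) :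
    b ≤ 0 := by
  by_contra! hb
  have h1 := h ((|a| + 1) / b) (by positivity)
  rw [div_mul_cancel₀ _ hb.ne'] at h1
  have := neg_abs_le a
  linarith

/-- A packing linear program in which every variable is bounded by some constraint attains its
maximum, because its feasible region is compact. -/
theorem exists_isMaxOn_packing {I J : Type*} [Fintype I] (M : J → I → ℝ)
    (hM : ∀ j i, 0 ≤ M j i) (u : J → ℝ) (hu : ∀ j, 0 < u j) (c : I → ℝ) (hcol : ∀ i, ∃ j, 0 < M j i) :
    ∃ x : I → ℝ, (∀ i, 0 ≤ x i) ∧ (∀ j, ∑ i, M j i * x i ≤ u j) ∧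
      ∀ x' : I → ℝ, (∀ i, 0 ≤ x' i) → (∀ j, ∑ i, M j i * x' i ≤ u j) →
        ∑ i, c i * x' i ≤ ∑ i, c i * x i := by
  set K : Set (I → ℝ) := {x | (∀ i, 0 ≤ x i) ∧ ∀ j, ∑ i, M j i * x i ≤ u j} with hK
  have hclosed : IsClosed K := by
    have : K = (⋂ i, {x : I → ℝ | 0 ≤ x i}) ∩ ⋂ j, {x : I → ℝ | ∑ i, M j i * x i ≤ u j} := by
      ext x
      simp [hK]
    rw [this]
    exact (isClosed_iInter fun i => isClosed_le (by fun_prop) (by fun_prop)).inter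
      (isClosed_iInter fun j => isClosed_le (by fun_prop) (by fun_prop))
  choose j hj using hcol
  have hsub : K ⊆ Set.Icc 0 (fun i => u (j i) / M (j i) i) := by
    rintro x ⟨h0, h1⟩
    refine ⟨h0, fun i => ?_⟩
    rw [le_div_iff₀ (hj i), mul_comm]
    refine le_trans ?_ (h1 (j i))
    exact Finset.single_le_sum (f := fun i' => M (j i) i' * x i')
      (fun i' _ => mul_nonneg (hM _ _) (h0 _)) (Finset.mem_univ i)
  have hcompact : IsCompact K := isCompact_Icc.of_isClosed_subset hclosed hsub
  have hne : K.Nonempty := ⟨0, fun i => le_rfl, fun j => by simpa using (hu j).le⟩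
  obtain ⟨x, hx, hmax⟩ := hcompact.exists_isMaxOn hne
    (f := fun x : I → ℝ => ∑ i, c i * x i) (by fun_prop)
  exact ⟨x, hx.1, hx.2, fun x' h0 h1 => hmax (show x' ∈ K from ⟨h0, h1⟩)⟩

/-- Strong duality for packing linear programs, `max c x` subject to `M x ≤ u`, `x ≥ 0`: given
an upper bound `v` of the program, the pairs (objective surplus over `v`, slacks) that are strictly
dominated by nonnegative points form an open convex set without the origin.  A separating
functional consists of the multipliers; as `u > 0` (Slater's condition), that of the objective is
not zero. -/
theorem exists_packing_multipliers {I J : Type*} [Fintype I] [Fintype J] (M : J → I → ℝ)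
    (u : J → ℝ) (hu : ∀ j, 0 < u j) (c : I → ℝ) (v : ℝ)
    (hv : ∀ x : I → ℝ, (∀ i, 0 ≤ x i) → (∀ j, ∑ i, M j i * x i ≤ u j) →
      ∑ i, c i * x i ≤ v) :
    ∃ y : J → ℝ, (∀ j, 0 ≤ y j) ∧ (∀ i, c i ≤ ∑ j, y j * M j i) ∧ ∑ j, u j * y j ≤ v := by
  classical
  set C : Set (ℝ × (J → ℝ)) := {p | ∃ x : I → ℝ, (∀ i, 0 ≤ x i) ∧
    p.1 < ∑ i, c i * x i - v ∧ ∀ j, p.2 j < u j - ∑ i, M j i * x i} with hC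
  have hopen : IsOpen C := by
    have : C = ⋃ x : I → ℝ, ⋃ _ : ∀ i, 0 ≤ x i, {p : ℝ × (J → ℝ) | p.1 < ∑ i, c i * x i - v} ∩
        ⋂ j, {p : ℝ × (J → ℝ) | p.2 j < u j - ∑ i, M j i * x i} := by
      ext p
      simp only [hC, Set.mem_iUnion, Set.mem_inter_iff, Set.mem_iInter, Set.mem_ofPred_eq,
        exists_prop]
    rw [this]
    exact isOpen_iUnion fun x => isOpen_iUnion fun _ =>
      (isOpen_lt (by fun_prop) (by fun_prop)).inter
        (isOpen_iInter_of_finite fun j => isOpen_lt (by fun_prop) (by fun_prop))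
  have hconv : Convex ℝ C := by
    rintro p ⟨x, hx0, hx1, hx2⟩ q ⟨x', hx0', hx1', hx2'⟩ a b ha hb hab
    refine ⟨fun i => a * x i + b * x' i, fun i => ?_, ?_, fun j => ?_⟩
    · have := hx0 i; have := hx0' i; positivity
    · have e : ∑ i, c i * (a * x i + b * x' i) - v
          = a * (∑ i, c i * x i - v) + b * (∑ i, c i * x' i - v) := by
        have : v = (a + b) * v := by rw [hab, one_mul]
        rw [mul_sub, mul_sub, Finset.mul_sum, Finset.mul_sum]
        simp only [mul_add, Finset.sum_add_distrib]
        simp only [mul_left_comm (c _)]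
        linarith
      rw [e]
      exact convex_combination_lt ha hb hab hx1 hx1'
    · have e : u j - ∑ i, M j i * (a * x i + b * x' i)
          = a * (u j - ∑ i, M j i * x i) + b * (u j - ∑ i, M j i * x' i) := by
        have : u j = (a + b) * u j := by rw [hab, one_mul]
        rw [mul_sub, mul_sub, Finset.mul_sum, Finset.mul_sum]
        simp only [mul_add, Finset.sum_add_distrib]
        simp only [mul_left_comm (M j _)]
        linarith
      rw [e]
      exact convex_combination_lt ha hb hab (hx2 j) (hx2' j)
  have h0 : (0 : ℝ × (J → ℝ)) ∉ C := by
    rintro ⟨x, hx0, hx1, hx2⟩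
    have := hv x hx0 fun j => by have := hx2 j; simp at this; linarith
    simp at hx1
    linarith
  obtain ⟨φ, hφ⟩ := geometric_hahn_banach_open_point hconv hopen h0
  rw [map_zero] at hφ
  set l : ℝ := φ (1, 0)
  set y : J → ℝ := fun j => φ (0, Pi.single j 1) with hy
  have hrep : ∀ r z, φ (r, z) = r * l + ∑ j, z j * y j := by
    intro r z
    have : ((r, z) : ℝ × (J → ℝ)) = r • (1, 0) + ∑ j, z j • (0, Pi.single j 1) := by
      refine Prod.ext ?_ ?_
      · simp [Prod.fst_sum]
      · ext k
        simp [Prod.snd_sum, Finset.sum_apply, Pi.single_apply]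
    rw [this, map_add, map_smul, map_sum]
    simp only [map_smul, smul_eq_mul, l, hy]
  -- `φ` is negative on the open set, and hence nonpositive where the strict inequalities are
  -- relaxed to weak ones.
  have hstrict : ∀ x : I → ℝ, (∀ i, 0 ≤ x i) → ∀ (s : ℝ) (w : J → ℝ), 0 < s → (∀ j, 0 < w j) →
      (∑ i, c i * x i - v - s) * l + ∑ j, (u j - ∑ i, M j i * x i - w j) * y j < 0 := by
    intro x hx s w hs hw
    rw [← hrep]
    exact hφ _ ⟨x, hx, by simpa using hs, fun j => by simpa using hw j⟩
  have hweak : ∀ x : I → ℝ, (∀ i, 0 ≤ x i) → ∀ (s : ℝ) (w : J → ℝ), 0 ≤ s → (∀ j, 0 ≤ w j) →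
      (∑ i, c i * x i - v - s) * l + ∑ j, (u j - ∑ i, M j i * x i - w j) * y j ≤ 0 := by
    intro x hx s w hs hw
    have hε : ∀ ε : ℝ, 0 < ε →
        (∑ i, c i * x i - v - s) * l + ∑ j, (u j - ∑ i, M j i * x i - w j) * y j
          < ε * (l + ∑ j, y j) := by
      intro ε hε
      have h := hstrict x hx (s + ε) (fun j => w j + ε) (by positivity)
        (fun j => by have := hw j; positivity)
      have e : ∑ j, (u j - ∑ i, M j i * x i - (w j + ε)) * y j
          = ∑ j, (u j - ∑ i, M j i * x i - w j) * y j - ε * ∑ j, y j := by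
        rw [Finset.mul_sum, ← Finset.sum_sub_distrib]
        exact Finset.sum_congr rfl fun j _ => by ring
      rw [e] at h
      linarith
    by_contra! hpos
    set a := (∑ i, c i * x i - v - s) * l + ∑ j, (u j - ∑ i, M j i * x i - w j) * y j
    have h := hε (a / (|l + ∑ j, y j| + 1)) (by positivity)
    have h1 : a / (|l + ∑ j, y j| + 1) * (l + ∑ j, y j)
        ≤ a / (|l + ∑ j, y j| + 1) * (|l + ∑ j, y j| + 1) :=
      mul_le_mul_of_nonneg_left ((le_abs_self _).trans (lt_add_one _).le) (by positivity)
    rw [div_mul_cancel₀ _ (by positivity)] at h1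
    linarith
  have hl : 0 ≤ l := by
    refine neg_nonpos.mp (nonpos_of_forall_add_mul_nonpos (a := -v * l + ∑ j, u j * y j) ?_)
    intro t ht
    have := hweak 0 (fun _ => le_rfl) t 0 ht (fun _ => le_rfl)
    simp at this
    linarith
  have hy0 : ∀ j, 0 ≤ y j := by
    intro k
    refine neg_nonpos.mp (nonpos_of_forall_add_mul_nonpos (a := -v * l + ∑ j, u j * y j) ?_)
    intro t ht
    have := hweak 0 (fun _ => le_rfl) 0 (Pi.single k t) le_rfl (fun j => by
      by_cases h : j = k
      · subst h; simpa using ht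
      · simp [h])
    simp [sub_mul, Finset.sum_sub_distrib, Pi.single_apply] at this
    linarith
  -- Slater: if `l = 0`, strictness fails at `x = 0` with all slacks used up, which is a point
  -- of the open set since `u > 0`.
  have hlpos : 0 < l := by
    refine lt_of_le_of_ne hl fun hl0 => ?_
    have h1 := hstrict 0 (fun _ => le_rfl) 1 (fun j => u j) one_pos hu
    simp [← hl0] at h1
  refine ⟨fun j => y j / l, fun j => div_nonneg (hy0 j) hl, fun i => ?_, ?_⟩
  · have h : c i * l - ∑ j, y j * M j i ≤ 0 := by
      refine nonpos_of_forall_add_mul_nonpos (a := -v * l + ∑ j, u j * y j) ?_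
      intro t ht
      have := hweak (Pi.single i t) (fun j => by
        by_cases h : j = i
        · subst h; simpa using ht
        · simp [h]) 0 0 le_rfl (fun _ => le_rfl)
      simp [sub_mul, Finset.sum_sub_distrib, Pi.single_apply] at this
      have e : ∑ j, M j i * t * y j = t * ∑ j, y j * M j i := by
        rw [Finset.mul_sum]; exact Finset.sum_congr rfl fun j _ => by ring
      rw [e] at this
      linarith
    simp only [div_mul_eq_mul_div]
    rw [← Finset.sum_div, le_div_iff₀ hlpos]
    linarith
  · have := hweak 0 (fun _ => le_rfl) 0 0 le_rfl (fun _ => le_rfl)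
    simp at this
    simp only [← mul_div_assoc]
    rw [← Finset.sum_div, div_le_iff₀ hlpos]
    linarith

/-! ### Cuts over time and weak duality -/

namespace Network

variable {V A : Type*}

/-- The capacity of the cut over time in which node `v` belongs to the source side from time
`p v` on: an arc `a` crosses it at its tail during `[p (tail a), p (head a) - transit a)`. -/
noncomputable def cutCapacity [Fintype A] (N : Network V A) (p : V → ℝ) : ℝ≥0∞ :=
  ∑ a, N.cap a * ENNReal.ofReal (p (N.head a) - p (N.tail a) - N.transit a)

/-- The switching times `p` define a cut over time that separates the sources in `X` from the sinks
outside `X` within the time horizon `θ`. -/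
structure IsSeparating [DecidableEq V] (N : Network V A) (θ : ℝ) (X : Finset V)
    (p : V → ℝ) : Prop where
  nonneg : ∀ v, 0 ≤ p v
  le_horizon : ∀ v, p v ≤ θ
  source : ∀ s ∈ N.sources ∩ X, p s = 0
  sink : ∀ s ∈ N.sinks \ X, p s = θ

/-- The pointwise minimum of switching times is the union of the source sides. -/
theorem IsSeparating.inf [DecidableEq V] {N : Network V A} {θ : ℝ} {X Y : Finset V} {p q : V → ℝ}
    (hp : N.IsSeparating θ X p) (hq : N.IsSeparating θ Y q) :
    N.IsSeparating θ (X ∪ Y) (p ⊓ q) where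
  nonneg v := le_min (hp.nonneg v) (hq.nonneg v)
  le_horizon v := (min_le_left _ _).trans (hp.le_horizon v)
  source s hs := by
    simp only [Finset.mem_inter, Finset.mem_union] at hs
    rcases hs with ⟨hs, hX | hY⟩
    · simp [hp.source s (Finset.mem_inter.2 ⟨hs, hX⟩), hq.nonneg s]
    · simp [hq.source s (Finset.mem_inter.2 ⟨hs, hY⟩), hp.nonneg s]
  sink s hs := by
    simp only [Finset.mem_sdiff, Finset.mem_union, not_or] at hs
    simp [hp.sink s (Finset.mem_sdiff.2 ⟨hs.1, hs.2.1⟩),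
      hq.sink s (Finset.mem_sdiff.2 ⟨hs.1, hs.2.2⟩)]

/-- The pointwise maximum of switching times is the intersection of the source sides. -/
theorem IsSeparating.sup [DecidableEq V] {N : Network V A} {θ : ℝ} {X Y : Finset V} {p q : V → ℝ}
    (hp : N.IsSeparating θ X p) (hq : N.IsSeparating θ Y q) :
    N.IsSeparating θ (X ∩ Y) (p ⊔ q) where
  nonneg v := le_max_of_le_left (hp.nonneg v)
  le_horizon v := max_le (hp.le_horizon v) (hq.le_horizon v)
  source s hs := by
    simp only [Finset.mem_inter] at hs
    simp [hp.source s (Finset.mem_inter.2 ⟨hs.1, hs.2.1⟩),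
      hq.source s (Finset.mem_inter.2 ⟨hs.1, hs.2.2⟩)]
  sink s hs := by
    simp only [Finset.mem_sdiff, Finset.mem_inter, not_and_or] at hs
    rcases hs with ⟨hs, hX | hY⟩
    · simp [hp.sink s (Finset.mem_sdiff.2 ⟨hs, hX⟩), hq.le_horizon s]
    · simp [hq.sink s (Finset.mem_sdiff.2 ⟨hs, hY⟩), hp.le_horizon s]

/-- Submodularity of `(v, w) ↦ (w - v - τ)⁺`, a convex function of the difference. -/
theorem max_zero_min_sub_add_max_zero_max_sub_le (v w v' w' τ : ℝ) :
    max 0 (min w w' - min v v' - τ) + max 0 (max w w' - max v v' - τ)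
      ≤ max 0 (w - v - τ) + max 0 (w' - v' - τ) := by
  grind

theorem cutCapacity_inf_add_cutCapacity_sup_le [Fintype A] (N : Network V A) (p q : V → ℝ) :
    N.cutCapacity (p ⊓ q) + N.cutCapacity (p ⊔ q) ≤ N.cutCapacity p + N.cutCapacity q := by
  have key (x : ℝ) : ENNReal.ofReal x = ENNReal.ofReal (max 0 x) := by
    rw [max_comm, ENNReal.ofReal_max]; simp
  simp only [cutCapacity, ← Finset.sum_add_distrib, ← mul_add]
  refine Finset.sum_le_sum fun a _ => mul_le_mul_right ?_ _
  rw [key, key (p _ - _ - _), key (_ - _ - _), key (q _ - _ - _),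
    ← ENNReal.ofReal_add (le_max_left _ _) (le_max_left _ _),
    ← ENNReal.ofReal_add (le_max_left _ _) (le_max_left _ _)]
  exact ENNReal.ofReal_le_ofReal (max_zero_min_sub_add_max_zero_max_sub_le _ _ _ _ _)

/-- The net flow out of the source side of the cut over time `p`, arc by arc: what enters an arc
while its tail is on the source side, minus what leaves it while its head is there. -/
theorem sum_netOut_integral [Fintype V] [DecidableEq V] [Fintype A] (N : Network V A)
    (f : A → ℝ → ℝ)
    (hf : ∀ a, MeasureTheory.Integrable (f a)) (p : V → ℝ) :
    ∑ v, ∫ t in Set.Ici (p v), N.netOut f v t =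
      ∑ a, ((∫ t in Set.Ici (p (N.tail a)), f a t) -
        ∫ t in Set.Ici (p (N.head a) - N.transit a), f a t) := by
  have h1 (v : V) : ∫ t in Set.Ici (p v), N.netOut f v t =
      (∑ a with N.tail a = v, ∫ t in Set.Ici (p (N.tail a)), f a t) -
        ∑ a with N.head a = v, ∫ t in Set.Ici (p (N.head a) - N.transit a), f a t := by
    simp only [netOut]
    rw [MeasureTheory.integral_sub
      (MeasureTheory.integrable_finsetSum _ fun a _ => (hf a).integrableOn)
      (MeasureTheory.integrable_finsetSum _ fun a _ =>
        ((hf a).comp_sub_right (N.transit a)).integrableOn),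
      MeasureTheory.integral_finsetSum _ fun a _ => (hf a).integrableOn,
      MeasureTheory.integral_finsetSum _ fun a _ =>
        ((hf a).comp_sub_right (N.transit a)).integrableOn]
    congr 1
    · refine Finset.sum_congr rfl fun a ha => ?_
      rw [(Finset.mem_filter.1 ha).2]
    · refine Finset.sum_congr rfl fun a ha => ?_
      rw [(Finset.mem_filter.1 ha).2]
      have := (MeasureTheory.measurePreserving_sub_right MeasureTheory.volume
        (N.transit a)).setIntegral_preimage_emb
        (MeasurableEquiv.subRight (N.transit a)).measurableEmbedding (f a)
        (Set.Ici (p v - N.transit a))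
      rw [← this]
      simp
  simp only [h1, Finset.sum_sub_distrib, Finset.sum_fiberwise]

theorem ofReal_setIntegral_Ici_sub_le {g : ℝ → ℝ} (hg : MeasureTheory.Integrable g)
    (h0 : ∀ t, 0 ≤ g t) {u : ℝ≥0∞} (hu : ∀ t, ENNReal.ofReal (g t) ≤ u) (x y : ℝ) :
    ENNReal.ofReal ((∫ t in Set.Ici x, g t) - ∫ t in Set.Ici y, g t)
      ≤ u * ENNReal.ofReal (y - x) := by
  rcases le_total y x with h | h
  · have : ∫ t in Set.Ici x, g t ≤ ∫ t in Set.Ici y, g t :=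
      MeasureTheory.setIntegral_mono_set hg.integrableOn
        (Filter.Eventually.of_forall h0) (Set.Ici_subset_Ici.2 h).eventuallyLE
    rw [ENNReal.ofReal_of_nonpos (by linarith)]
    exact zero_le
  · have : ∫ t in Set.Ici x, g t = (∫ t in Set.Ico x y, g t) + ∫ t in Set.Ici y, g t := by
      rw [← MeasureTheory.setIntegral_union _ measurableSet_Ici hg.integrableOn hg.integrableOn,
        Set.Ico_union_Ici_eq_Ici h]
      exact Set.disjoint_left.2 fun t h1 h2 => not_le.2 h1.2 h2
    rw [this, add_sub_cancel_right,
      MeasureTheory.ofReal_integral_eq_lintegral_ofReal hg.integrableOn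
        (Filter.Eventually.of_forall h0)]
    calc ∫⁻ t in Set.Ico x y, ENNReal.ofReal (g t) ≤ ∫⁻ _ in Set.Ico x y, u :=
          MeasureTheory.lintegral_mono hu
      _ = u * ENNReal.ofReal (y - x) := by simp

/-- Weak duality: the amount of a feasible flow equals the net flow leaving the source side of a
separating cut over time. -/
theorem amount_le_cutCapacity [Fintype V] [DecidableEq V] [Fintype A] {N : Network V A}
    {θ : ℝ} {X : Finset V} {p : V → ℝ} (hp : N.IsSeparating θ X p) {f : A → ℝ → ℝ}
    (hf : N.IsFeasible θ X f) :
    ENNReal.ofReal (N.amount X f) ≤ N.cutCapacity p := by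
  obtain ⟨⟨hint, hcons⟩, hcap, hhor⟩ := hf
  have hzero (v : V) {t : ℝ} (ht : t < 0 ∨ θ ≤ t) : N.netOut f v t = 0 := by
    simp [netOut, fun a => (hhor a t ht).1, fun a => (hhor a t ht).2]
  have hamount : N.amount X f = ∑ v, ∫ t in Set.Ici (p v), N.netOut f v t := by
    rw [amount, ← Finset.sum_subset (Finset.subset_univ (N.sources ∩ X))]
    -- Nodes in `sources ∩ X` are on the source side from time `0` on, before which nothing flows.
    · refine Finset.sum_congr rfl fun s hs => ?_
      rw [hp.source s hs, MeasureTheory.setIntegral_eq_integral_of_forall_compl_eq_zero]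
      exact fun t ht => hzero s (Or.inl (not_le.1 ht))
    -- Sinks outside `X` join at time `θ`, when nothing flows any more; elsewhere flow is conserved.
    · intro v _ hv
      refine MeasureTheory.setIntegral_eq_zero_of_forall_eq_zero fun t ht => ?_
      by_cases hv' : v ∈ N.sinks \ X
      · rw [hp.sink v hv'] at ht
        exact hzero v (Or.inr ht)
      · exact hcons v (by simp only [Finset.mem_union]; tauto) t
  rw [hamount, N.sum_netOut_integral f hint p]
  refine (Finset.le_sum_of_subadditive ENNReal.ofReal ENNReal.ofReal_zero.le
    (fun _ _ => ENNReal.ofReal_add_le) _ _).trans (Finset.sum_le_sum fun a _ => ?_)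
  rw [sub_right_comm]
  exact ofReal_setIntegral_Ici_sub_le (hint a) (fun t => (hcap a t).1) (fun t => (hcap a t).2) _ _

theorem maxFlow_le_cutCapacity [Fintype V] [DecidableEq V] [Fintype A] {N : Network V A}
    {θ : ℝ} {X : Finset V} {p : V → ℝ} (hp : N.IsSeparating θ X p) :
    N.maxFlow θ X ≤ N.cutCapacity p := by
  refine iSup₂_le ?_
  rintro _ ⟨f, hf, rfl⟩
  exact amount_le_cutCapacity hp hf

/-! ### Walks and temporally repeated flows -/

/-- The list `l` of arcs is a directed walk from `v` to `w`. -/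
def IsWalk (N : Network V A) : V → List A → V → Prop
  | v, [], w => v = w
  | v, a :: l, w => N.tail a = v ∧ IsWalk N (N.head a) l w

/-- The total transit time of a list of arcs. -/
def walkTransit (N : Network V A) (l : List A) : ℝ := (l.map N.transit).sum

theorem walkTransit_nonneg (N : Network V A) (l : List A) : 0 ≤ N.walkTransit l :=
  List.sum_nonneg (by simpa using fun a _ => N.transit_nonneg a)

theorem walkTransit_cons (N : Network V A) (a : A) (l : List A) :
    N.walkTransit (a :: l) = N.transit a + N.walkTransit l := by
  simp [walkTransit]

theorem IsWalk.concat {N : Network V A} {a : A} {v : V} {l : List A} (h : N.IsWalk v l (N.tail a)) :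
    N.IsWalk v (l ++ [a]) (N.head a) := by
  induction l generalizing v with
  | nil => exact ⟨Eq.symm h, rfl⟩
  | cons b l ih => exact ⟨h.1, ih h.2⟩

theorem IsWalk.of_append_cons {N : Network V A} {a : A} {v w : V} {l l' : List A}
    (h : N.IsWalk v (l ++ a :: l') w) : N.IsWalk v l (N.tail a) := by
  induction l generalizing v with
  | nil => exact Eq.symm h.1
  | cons b l ih => exact ⟨h.1, ih h.2⟩

/-- The flow over time that sends flow at unit rate along the walk `l`, starting at the times in
`[0, L)`. -/
noncomputable def walkFlow [DecidableEq A] (N : Network V A) (L : ℝ) : List A → A → ℝ → ℝ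
  | [], _, _ => 0
  | b :: l, a, t => (if a = b then (Set.Ico 0 L).indicator 1 t else 0) +
      walkFlow N L l a (t - N.transit b)

section WalkFlow

variable [DecidableEq A] (N : Network V A) (L : ℝ)

theorem walkFlow_nonneg (l : List A) (a : A) (t : ℝ) : 0 ≤ N.walkFlow L l a t := by
  induction l generalizing t with
  | nil => exact le_rfl
  | cons b l ih =>
    refine add_nonneg ?_ (ih _)
    split_ifs
    · exact Set.indicator_nonneg (fun _ _ => zero_le_one) _
    · exact le_rfl

theorem walkFlow_le_count (l : List A) (a : A) (t : ℝ) : N.walkFlow L l a t ≤ l.count a := by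
  induction l generalizing t with
  | nil => simp [walkFlow]
  | cons b l ih =>
    rw [walkFlow, List.count_cons, add_comm, Nat.cast_add]
    refine add_le_add (ih _) ?_
    by_cases h : a = b
    · subst h
      simpa using Set.indicator_le_self' (f := (1 : ℝ → ℝ)) (fun _ _ => zero_le_one) t
    · simp [h, Ne.symm h]

theorem integrable_walkFlow (l : List A) (a : A) :
    MeasureTheory.Integrable (N.walkFlow L l a) := by
  induction l with
  | nil => exact MeasureTheory.integrable_zero _ _ _
  | cons b l ih =>
    refine MeasureTheory.Integrable.add ?_ (ih.comp_sub_right (N.transit b))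
    split_ifs
    · exact (MeasureTheory.integrable_indicator_iff measurableSet_Ico).2
        (MeasureTheory.integrableOn_const (by simp))
    · exact MeasureTheory.integrable_zero _ _ _

/-- No flow enters an arc before time `0`, or so late that it would leave the arc after the last
unit has reached the end of the walk, at time `L` plus the transit time of the walk. -/
theorem walkFlow_eq_zero {l : List A} {a : A} {t : ℝ}
    (h : t < 0 ∨ L + N.walkTransit l ≤ t + N.transit a) : N.walkFlow L l a t = 0 := by
  induction l generalizing t with
  | nil => rfl
  | cons b l ih =>
    rw [walkTransit_cons] at h
    rw [walkFlow, ih, add_zero]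
    · split_ifs with hab
      · subst hab
        refine Set.indicator_of_notMem (fun ht => ?_) _
        have := N.walkTransit_nonneg l
        rcases h with h | h
        · linarith [ht.1]
        · linarith [ht.2]
      · rfl
    · have := N.transit_nonneg b
      exact h.imp (fun h => by linarith) fun h => by linarith

/-- Inner nodes of the walk forward what they receive, so that only the first node emits, and only
the last node absorbs, net flow. -/
theorem netOut_walkFlow [Fintype A] [DecidableEq V] {v w : V} {l : List A} (h : N.IsWalk v l w)
    (x : V) (t : ℝ) :
    N.netOut (N.walkFlow L l) x t = (if v = x then (Set.Ico 0 L).indicator 1 t else 0) -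
      if w = x then (Set.Ico 0 L).indicator 1 (t - N.walkTransit l) else 0 := by
  induction l generalizing v t with
  | nil =>
    obtain rfl : v = w := h
    simp [netOut, walkFlow, walkTransit]
  | cons b l ih =>
    obtain ⟨rfl, h⟩ := h
    have hstep : N.netOut (N.walkFlow L (b :: l)) x t =
        ((if N.tail b = x then (Set.Ico 0 L).indicator 1 t else 0) -
          if N.head b = x then (Set.Ico 0 L).indicator 1 (t - N.transit b) else 0) +
        N.netOut (N.walkFlow L l) x (t - N.transit b) := by
      simp only [netOut, walkFlow, Finset.sum_add_distrib, Finset.sum_ite_eq', Finset.mem_filter,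
        Finset.mem_univ, true_and, sub_right_comm t]
      ring
    rw [hstep, ih h, walkTransit_cons, sub_sub t]
    ring

end WalkFlow

/-- A walk from a source in `X` to a sink outside `X` that repeats no arc and along which flow can
travel within the time horizon `θ`. -/
def IsFlowWalk [DecidableEq V] (N : Network V A) (θ : ℝ) (X : Finset V) (l : List A) : Prop :=
  l.Nodup ∧ N.walkTransit l < θ ∧ ∃ s ∈ N.sources ∩ X, ∃ w ∈ N.sinks \ X, N.IsWalk s l w

section Repeated

variable [DecidableEq V] [Fintype A] [DecidableEq A] {N : Network V A} {θ : ℝ} {X : Finset V}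
  {I : Type*} [Fintype I]

/-- The temporally repeated flow with rate `x i` along the walk `l i`: flow is sent along every
walk for as long as it can arrive before the time horizon. -/
noncomputable def repeatedFlow (N : Network V A) (θ : ℝ) (l : I → List A) (x : I → ℝ) (a : A)
    (t : ℝ) : ℝ :=
  ∑ i, x i * N.walkFlow (θ - N.walkTransit (l i)) (l i) a t

theorem netOut_repeatedFlow (l : I → List A) (x : I → ℝ) (v : V) (t : ℝ) :
    N.netOut (N.repeatedFlow θ l x) v t =
      ∑ i, x i * N.netOut (N.walkFlow (θ - N.walkTransit (l i)) (l i)) v t := by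
  simp only [netOut, repeatedFlow, mul_sub, Finset.sum_sub_distrib, Finset.mul_sum]
  rw [Finset.sum_comm, Finset.sum_comm (s := Finset.univ.filter _) (t := Finset.univ)]

theorem isFeasible_repeatedFlow {l : I → List A} (hl : ∀ i, N.IsFlowWalk θ X (l i)) {x : I → ℝ}
    (hx : ∀ i, 0 ≤ x i)
    (hcap : ∀ a, N.cap a ≠ ⊤ → ∑ i, (l i).count a * x i ≤ (N.cap a).toReal) :
    N.IsFeasible θ X (N.repeatedFlow θ l x) := by
  refine ⟨⟨fun a => ?_, fun v hv t => ?_⟩, fun a t => ⟨?_, ?_⟩, fun a t ht => ?_⟩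
  · exact MeasureTheory.integrable_finsetSum _ fun i _ =>
      (N.integrable_walkFlow _ _ a).const_mul (x i)
  · rw [netOut_repeatedFlow]
    refine Finset.sum_eq_zero fun i _ => ?_
    obtain ⟨-, -, s, hs, w, hw, hwalk⟩ := hl i
    rw [netOut_walkFlow N _ hwalk, if_neg, if_neg, sub_zero, mul_zero]
    · rintro rfl
      exact hv (Finset.mem_union_right _ hw)
    · rintro rfl
      exact hv (Finset.mem_union_left _ hs)
  · exact Finset.sum_nonneg fun i _ => mul_nonneg (hx i) (N.walkFlow_nonneg _ _ _ _)
  · by_cases ha : N.cap a = ⊤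
    · simp [ha]
    · refine ENNReal.ofReal_le_of_le_toReal (le_trans (Finset.sum_le_sum fun i _ => ?_) (hcap a ha))
      rw [mul_comm]
      exact mul_le_mul_of_nonneg_right (N.walkFlow_le_count _ _ _ _) (hx i)
  · have := N.transit_nonneg a
    constructor <;>
    · refine Finset.sum_eq_zero fun i _ => ?_
      rw [walkFlow_eq_zero, mul_zero]
      rw [sub_add_cancel]
      exact ht.imp (fun h => by linarith) fun h => by linarith

theorem amount_repeatedFlow {l : I → List A} (hl : ∀ i, N.IsFlowWalk θ X (l i)) (x : I → ℝ) :
    N.amount X (N.repeatedFlow θ l x) = ∑ i, (θ - N.walkTransit (l i)) * x i := by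
  have hint (v : V) (i : I) : MeasureTheory.Integrable
      (fun t => x i * N.netOut (N.walkFlow (θ - N.walkTransit (l i)) (l i)) v t) := by
    refine MeasureTheory.Integrable.const_mul ?_ _
    exact (MeasureTheory.integrable_finsetSum _ fun a _ => N.integrable_walkFlow _ _ a).sub
      (MeasureTheory.integrable_finsetSum _ fun a _ =>
        (N.integrable_walkFlow _ _ a).comp_sub_right (N.transit a))
  simp only [amount, netOut_repeatedFlow]
  simp_rw [MeasureTheory.integral_finsetSum _ fun i _ => hint _ i]
  rw [Finset.sum_comm]
  refine Finset.sum_congr rfl fun i _ => ?_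
  obtain ⟨-, hθ, s, hs, w, hw, hwalk⟩ := hl i
  have hws (v : V) (hv : v ∈ N.sources ∩ X) : w ≠ v := by
    rintro rfl
    exact Finset.disjoint_left.1 N.disjoint_sources_sinks (Finset.mem_inter.1 hv).1
      (Finset.mem_sdiff.1 hw).1
  rw [Finset.sum_eq_single_of_mem s hs]
  · simp only [netOut_walkFlow N _ hwalk, if_neg (hws s hs), if_true, sub_zero]
    rw [MeasureTheory.integral_const_mul, MeasureTheory.integral_indicator_one measurableSet_Ico]
    simp [mul_comm, hθ.le]
  · intro v hv hvs
    simp [netOut_walkFlow N _ hwalk, hws v hv, hvs.symm]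

end Repeated

/-- A walk of uncapacitated arcs along which flow can arrive in time carries arbitrarily
much flow. -/
theorem maxFlow_eq_top_of_walk [DecidableEq V] [Fintype A] {N : Network V A} {θ : ℝ} {X : Finset V}
    {l : List A} (hl : N.IsFlowWalk θ X l) (htop : ∀ a ∈ l, N.cap a = ⊤) : N.maxFlow θ X = ⊤ := by
  classical
  have hpos : 0 < θ - N.walkTransit l := sub_pos.2 hl.2.1
  refine ENNReal.eq_top_of_forall_nnreal_le fun r => ?_
  have hmem : (r : ℝ) ∈ N.amounts θ X := by
    refine ⟨N.repeatedFlow θ (fun _ : Unit => l) fun _ => r / (θ - N.walkTransit l),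
      isFeasible_repeatedFlow (fun _ => hl) (fun _ => by positivity) fun a ha => ?_, ?_⟩
    · rw [List.count_eq_zero_of_not_mem fun h => ha (htop a h)]
      simp
    · rw [amount_repeatedFlow fun _ => hl]
      simp [mul_div_cancel₀ _ hpos.ne']
  refine le_trans ?_ (le_iSup₂ (f := fun (r : ℝ) (_ : r ∈ N.amounts θ X) => ENNReal.ofReal r)
    (r : ℝ) hmem)
  simp

/-! ### Cuts over time from shortest walks -/

/-- The earliest time, cut off at `θ`, at which a walk from a source in `X` can reach `v` if the
transit times are prolonged by `y`. -/
noncomputable def arrivalTime [DecidableEq V] (N : Network V A) (θ : ℝ) (X : Finset V) (y : A → ℝ)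
    (v : V) : ℝ :=
  sInf (insert θ {r | ∃ l : List A, l.Nodup ∧ (∃ s ∈ N.sources ∩ X, N.IsWalk s l v) ∧
    (l.map fun a => N.transit a + y a).sum = r})

section ArrivalTime

variable [DecidableEq V] {N : Network V A} {θ : ℝ} {X : Finset V} {y : A → ℝ}

theorem zero_mem_lowerBounds_arrival (hθ : 0 ≤ θ) (hy : ∀ a, 0 ≤ y a) (v : V) :
    0 ∈ lowerBounds (insert θ {r | ∃ l : List A, l.Nodup ∧
      (∃ s ∈ N.sources ∩ X, N.IsWalk s l v) ∧ (l.map fun a => N.transit a + y a).sum = r}) := by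
  rintro r (rfl | ⟨l, -, -, rfl⟩)
  · exact hθ
  · exact List.sum_nonneg (by simpa using fun a _ => add_nonneg (N.transit_nonneg a) (hy a))

theorem arrivalTime_le_horizon (hθ : 0 ≤ θ) (hy : ∀ a, 0 ≤ y a) (v : V) :
    N.arrivalTime θ X y v ≤ θ :=
  csInf_le ⟨0, zero_mem_lowerBounds_arrival hθ hy v⟩ (Set.mem_insert _ _)

theorem arrivalTime_le (hθ : 0 ≤ θ) (hy : ∀ a, 0 ≤ y a) {s v : V} (hs : s ∈ N.sources ∩ X)
    {l : List A} (hl : l.Nodup) (h : N.IsWalk s l v) :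
    N.arrivalTime θ X y v ≤ (l.map fun a => N.transit a + y a).sum :=
  csInf_le ⟨0, zero_mem_lowerBounds_arrival hθ hy v⟩ (Or.inr ⟨l, hl, ⟨s, hs, h⟩, rfl⟩)

theorem le_arrivalTime {v : V} {r : ℝ} (hr : r ≤ θ)
    (h : ∀ l : List A, l.Nodup → ∀ s ∈ N.sources ∩ X, N.IsWalk s l v →
      r ≤ (l.map fun a => N.transit a + y a).sum) : r ≤ N.arrivalTime θ X y v := by
  refine le_csInf (Set.insert_nonempty _ _) ?_
  rintro _ (rfl | ⟨l, hl, ⟨s, hs, hw⟩, rfl⟩)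
  · exact hr
  · exact h l hl s hs hw

/-- The triangle inequality for arrival times.  It bounds what the arc `a` contributes to the
capacity of the cut with switching times `arrivalTime` by `cap a * y a`. -/
theorem arrivalTime_head_le (hθ : 0 ≤ θ) (hy : ∀ a, 0 ≤ y a) (a : A) :
    N.arrivalTime θ X y (N.head a) - (N.transit a + y a) ≤ N.arrivalTime θ X y (N.tail a) := by
  have hz := add_nonneg (N.transit_nonneg a) (hy a)
  refine le_arrivalTime ?_ fun l hl s hs hw => ?_
  · have := arrivalTime_le_horizon (N := N) (X := X) hθ hy (N.head a)
    linarith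
  · by_cases ha : a ∈ l
    · -- A walk to the tail of `a` that has used `a` before has a shorter initial part to its head.
      obtain ⟨l₁, l₂, rfl⟩ := List.append_of_mem ha
      have hsub : (l₁ ++ [a]).Sublist (l₁ ++ a :: l₂) := by simp
      have h1 := arrivalTime_le hθ hy hs (hl.sublist hsub) hw.of_append_cons.concat
      have h2 : 0 ≤ (l₂.map fun a => N.transit a + y a).sum :=
        List.sum_nonneg (by simpa using fun a _ => add_nonneg (N.transit_nonneg a) (hy a))
      rw [List.map_append, List.sum_append, List.map_singleton, List.sum_singleton] at h1
      rw [List.map_append, List.sum_append, List.map_cons, List.sum_cons]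
      linarith
    · have hnd : (l ++ [a]).Nodup := by
        rw [← List.concat_eq_append]
        exact hl.concat ha
      have h1 := arrivalTime_le hθ hy hs hnd hw.concat
      rw [List.map_append, List.sum_append, List.map_singleton, List.sum_singleton] at h1
      linarith

/-- If `y` prolongs every walk in time to transit time at least `θ`, then no sink outside `X` is
reached before the horizon. -/
theorem isSeparating_arrivalTime (hθ : 0 ≤ θ) (hy : ∀ a, 0 ≤ y a)
    (hwalk : ∀ l, N.IsFlowWalk θ X l → θ - N.walkTransit l ≤ (l.map y).sum) :
    N.IsSeparating θ X (N.arrivalTime θ X y) where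
  nonneg v := le_csInf (Set.insert_nonempty _ _) (zero_mem_lowerBounds_arrival hθ hy v)
  le_horizon := arrivalTime_le_horizon hθ hy
  source s hs := le_antisymm (arrivalTime_le hθ hy hs List.nodup_nil rfl)
    (le_csInf (Set.insert_nonempty _ _) (zero_mem_lowerBounds_arrival hθ hy s))
  sink w hw := by
    refine le_antisymm (arrivalTime_le_horizon hθ hy w) (le_arrivalTime le_rfl ?_)
    intro l hl s hs h
    rw [List.sum_map_add]
    change θ ≤ N.walkTransit l + _
    rcases lt_or_ge (N.walkTransit l) θ with hlt | hge
    · linarith [hwalk l ⟨hl, hlt, s, hs, w, hw, h⟩]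
    · have : 0 ≤ (l.map y).sum := List.sum_nonneg (by simpa using fun a _ => hy a)
      linarith

end ArrivalTime

/-! ### Max-flow min-cut and submodularity -/

/-- Strong duality: if the maximum flow over time is finite, then some feasible flow matches the
capacity of some separating cut over time. -/
theorem exists_cutCapacity_le_amount [DecidableEq V] [Fintype A] (N : Network V A) {θ : ℝ}
    (hθ : 0 ≤ θ) (X : Finset V) (hfin : N.maxFlow θ X ≠ ⊤) :
    ∃ f, N.IsFeasible θ X f ∧ ∃ p, N.IsSeparating θ X p ∧
      N.cutCapacity p ≤ ENNReal.ofReal (N.amount X f) := by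
  classical
  -- The path program: rates on the finitely many walks, constrained by the finite capacities.
  let I := {l : {l : List A // l.Nodup} // N.IsFlowWalk θ X l}
  let J := {a : A // N.cap a ≠ ⊤}
  let M : J → I → ℝ := fun a l => (l.1.1.count a.1 : ℝ)
  let u : J → ℝ := fun a => (N.cap a).toReal
  let c : I → ℝ := fun l => θ - N.walkTransit l.1
  have hu (a : J) : 0 < u a := ENNReal.toReal_pos (N.cap_pos a).ne' a.2
  have hcol (l : I) : ∃ a, 0 < M a l := by
    by_contra! h
    refine hfin (maxFlow_eq_top_of_walk l.2 fun a ha => ?_)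
    by_contra hcap
    have := h ⟨a, hcap⟩
    simp only [M, Nat.cast_nonpos, List.count_eq_zero] at this
    exact this ha
  obtain ⟨x, hx, hxu, hmax⟩ := exists_isMaxOn_packing M (fun _ _ => Nat.cast_nonneg _) u hu c hcol
  obtain ⟨y, hy, hyc, hyu⟩ := exists_packing_multipliers M u hu c _ hmax
  -- The multipliers, extended by zero to the arcs of infinite capacity.
  let z : A → ℝ := fun a => if h : N.cap a ≠ ⊤ then y ⟨a, h⟩ else 0
  have hz (a : A) : 0 ≤ z a := by
    simp only [z]
    split_ifs
    · exact hy _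
    · exact le_rfl
  have hzJ (a : J) : z a = y a := dif_pos a.2
  have hJ (g : A → ℝ) (hg : ∀ a, N.cap a = ⊤ → g a = 0) : ∑ a : J, g a = ∑ a, g a := by
    rw [← Finset.sum_subtype (Finset.univ.filter fun a => N.cap a ≠ ⊤) (by simp),
      Finset.sum_filter_of_ne]
    exact fun a _ ha hcap => ha (hg a hcap)
  have hsum (l : List A) : ∑ a : J, y a * l.count a.1 = (l.map z).sum := by
    simp only [← hzJ]
    rw [hJ (fun a => z a * l.count a) fun a ha => by simp [z, ha], Finset.sum_list_map_count]
    refine (Finset.sum_subset (Finset.subset_univ _) fun a _ ha => ?_).symm.trans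
      (Finset.sum_congr rfl fun a _ => ?_)
    · rw [List.count_eq_zero_of_not_mem (by simpa using ha), Nat.cast_zero, mul_zero]
    · rw [nsmul_eq_mul, mul_comm]
  have hwalk (l : List A) (hl : N.IsFlowWalk θ X l) : θ - N.walkTransit l ≤ (l.map z).sum := by
    rw [← hsum]
    exact hyc ⟨⟨l, hl.1⟩, hl⟩
  refine ⟨N.repeatedFlow θ (fun l : I => l.1.1) x,
    isFeasible_repeatedFlow (fun l => l.2) hx fun a ha => hxu ⟨a, ha⟩,
    N.arrivalTime θ X z, isSeparating_arrivalTime hθ hz hwalk, ?_⟩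
  rw [amount_repeatedFlow fun l : I => l.2]
  have hcut (a : A) : N.cap a * ENNReal.ofReal (N.arrivalTime θ X z (N.head a) -
      N.arrivalTime θ X z (N.tail a) - N.transit a) ≤
        ENNReal.ofReal ((N.cap a).toReal * z a) := by
    have h1 : N.arrivalTime θ X z (N.head a) - N.arrivalTime θ X z (N.tail a) - N.transit a
        ≤ z a := by
      have := arrivalTime_head_le (N := N) (X := X) hθ hz a
      linarith
    refine (mul_le_mul_right (ENNReal.ofReal_le_ofReal h1) _).trans ?_
    by_cases ha : N.cap a = ⊤
    · simp [z, ha]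
    · rw [ENNReal.ofReal_mul ENNReal.toReal_nonneg, ENNReal.ofReal_toReal ha]
  refine (Finset.sum_le_sum fun a _ => hcut a).trans ?_
  rw [← ENNReal.ofReal_sum_of_nonneg fun a _ => mul_nonneg ENNReal.toReal_nonneg (hz a)]
  refine ENNReal.ofReal_le_ofReal (le_trans (le_of_eq ?_) hyu)
  simp only [← hzJ]
  exact (hJ (fun a => (N.cap a).toReal * z a) fun a ha => by simp [ha]).symm

theorem amount_nonneg [DecidableEq V] [Fintype A] {N : Network V A} {θ : ℝ} {X : Finset V}
    {f : A → ℝ → ℝ} (hf : N.IsFeasible θ X f) : 0 ≤ N.amount X f := by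
  refine Finset.sum_nonneg fun s hs => MeasureTheory.integral_nonneg fun t => ?_
  have hin : (Finset.univ.filter fun a => N.head a = s) = ∅ :=
    Finset.filter_eq_empty_iff.2 fun a _ h =>
      N.no_arc_into_source a (h ▸ (Finset.mem_inter.1 hs).1)
  simpa [netOut, hin] using Finset.sum_nonneg fun a _ => (hf.2.1 a t).1

theorem ofReal_amount_le_maxFlow [DecidableEq V] [Fintype A] {N : Network V A} {θ : ℝ}
    {X : Finset V} {f : A → ℝ → ℝ} (hf : N.IsFeasible θ X f) :
    ENNReal.ofReal (N.amount X f) ≤ N.maxFlow θ X :=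
  le_iSup₂ (f := fun (r : ℝ) (_ : r ∈ N.amounts θ X) => ENNReal.ofReal r) _ ⟨f, hf, rfl⟩

end Network

theorem mainTheorem1 {V A : Type*} [Fintype V] [DecidableEq V] [Fintype A]
    (N : Network V A) (θ : ℝ) (hθ : 0 ≤ θ) :
    ((∀ a, N.cap a ≠ ⊤) → ∀ X ⊆ N.terminals, N.maxFlow θ X ≠ ⊤) ∧
    (∀ X ⊆ N.terminals, N.maxFlow θ X ≠ ⊤ →
      IsGreatest (N.amounts θ X) (N.maxFlow θ X).toReal) ∧
    IsSubmodularOn N.terminals (N.maxFlow θ) := by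
  refine ⟨fun hcap X _ => ?_, fun X _ hX => ?_, fun X _ Y _ => ?_⟩
  -- With finite capacities every cut is finite, for example the one in which all nodes but the
  -- sinks outside `X` are on the source side from time `0` on.
  · have hp : N.IsSeparating θ X fun v => if v ∈ N.sinks \ X then θ else 0 := by
      refine ⟨fun v => ?_, fun v => ?_, fun s hs => if_neg fun hs' => ?_, fun s hs => if_pos hs⟩
      · split_ifs
        exacts [hθ, le_rfl]
      · split_ifs
        exacts [le_rfl, hθ]
      · exact Finset.disjoint_left.1 N.disjoint_sources_sinks (Finset.mem_inter.1 hs).1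
          (Finset.mem_sdiff.1 hs').1
    refine ne_top_of_le_ne_top (ENNReal.sum_ne_top.2 fun a _ => ?_)
      (Network.maxFlow_le_cutCapacity hp)
    exact ENNReal.mul_ne_top (hcap a) ENNReal.ofReal_ne_top
  · obtain ⟨f, hf, p, hp, hle⟩ := N.exists_cutCapacity_le_amount hθ X hX
    have hamount : 0 ≤ N.amount X f := Network.amount_nonneg hf
    have heq : N.maxFlow θ X = ENNReal.ofReal (N.amount X f) :=
      le_antisymm ((Network.maxFlow_le_cutCapacity hp).trans hle)
        (Network.ofReal_amount_le_maxFlow hf)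
    rw [heq, ENNReal.toReal_ofReal hamount]
    refine ⟨⟨f, hf, rfl⟩, ?_⟩
    rintro _ ⟨g, hg, rfl⟩
    exact (ENNReal.ofReal_le_ofReal_iff hamount).1 (heq ▸ Network.ofReal_amount_le_maxFlow hg)
  · by_cases hX : N.maxFlow θ X = ⊤
    · simp [hX]
    by_cases hY : N.maxFlow θ Y = ⊤
    · simp [hY]
    obtain ⟨f, hf, p, hp, hpf⟩ := N.exists_cutCapacity_le_amount hθ X hX
    obtain ⟨g, hg, q, hq, hqg⟩ := N.exists_cutCapacity_le_amount hθ Y hY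
    calc N.maxFlow θ (X ∪ Y) + N.maxFlow θ (X ∩ Y)
        ≤ N.cutCapacity (p ⊓ q) + N.cutCapacity (p ⊔ q) :=
          add_le_add (Network.maxFlow_le_cutCapacity (hp.inf hq))
            (Network.maxFlow_le_cutCapacity (hp.sup hq))
      _ ≤ N.cutCapacity p + N.cutCapacity q := N.cutCapacity_inf_add_cutCapacity_sup_le p q
      _ ≤ N.maxFlow θ X + N.maxFlow θ Y :=
          add_le_add (hpf.trans (Network.ofReal_amount_le_maxFlow hf))
            (hqg.trans (Network.ofReal_amount_le_maxFlow hg))
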